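/- Let $F$ be a field of characteristic zero and let $E$ be the Grassmann (exterior) algebra over $F$, with unit, of a vector space $L$ with countably infinite basis $e_1,e_2,\dots$. Let $a,b$ be positive integers, $c$ an integer with $-b<c<a$, and $k$ a non-negative integer. Denote by $E_{(-b,c,a)}^{(\infty,k,\infty)}$ the algebra $E$ with a $\mathbb{Z}$-grading obtained by giving each generator $e_i$ one of the degrees $-b$, $c$, $a$, so that infinitely many generators have degree $-b$, exactly $k$ have degree $c$, and infinitely many have degree $a$, and by setting $\|e_{i_1}\cdots e_{i_s}\|=\|e_{i_1}\|+\cdots+\|e_{i_s}\|$. Let $F\langle X|\mathbb{Z}\rangle$ be the free unital associative $F$-algebra on $X=\bigcup_{g\in\mathbb{Z}}X_g$, where $X_g$ is a countably infinite set of variables of degree $g$, with its natural $\mathbb{Z}$-grading. A $T_{\mathbb{Z}}$-ideal is a two-sided ideal of $F\langle X|\mathbb{Z}\rangle$ invariant under all degree-preserving algebra endomorphisms. The graded identities of a $\mathbb{Z}$-graded algebra $A=\bigoplus_g A_g$ are the polynomials in $F\langle X|\mathbb{Z}\rangle$ that vanish under every substitution of elements of $A_g$ for the variables of degree $g$ $(g\in\mathbb{Z})$;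 they form a $T_{\mathbb{Z}}$-ideal $T_{\mathbb{Z}}(A)$. **Theorem.** Suppose that $\gcd(a,b,c)=1$ and that $\gcd(a,b)$, $\gcd(a,c)$, $\gcd(b,c)$ are all different from $1$ (condition $\hat B$). Let $d=\gcd(a,b)$, and assume that $(a/d)(b/d)$ is even and $k\ge d-1$. Then the $T_{\mathbb{Z}}$-ideal $T_{\mathbb{Z}}\bigl(E_{(-b,c,a)}^{(\infty,k,\infty)}\bigr)$ is generated, as a $T_{\mathbb{Z}}$-ideal, by the following polynomials in pairwise distinct variables: 1. $[x_1,x_2,x_3]=[[x_1,x_2],x_3]$, where $x_1,x_2,x_3\in X$ have arbitrary degrees; 2. $u_1u_2\cdots u_\alpha$, where the variables $u_i\in X$ have degrees not divisible by $d$, $\|u_i\|=q_id+r_ic$ with $q_i\in\mathbb{Z}$, $1\le r_i\le d-1$, and $r_1+\cdots+r_\alpha>k$. -/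

import Mathlib

namespace GradedGrassmann

/-! ### Integer gradings spanned by monomials -/

/-- The span of all monomials `v i₁ * ⋯ * v iₛ` (including the empty monomial `1`) whose total
degree `deg i₁ + ⋯ + deg iₛ` equals `g`. -/
def monomialComponent {ι : Type*} (F : Type*) [Field F] {A : Type*} [Ring A] [Algebra F A]
    (v : ι → A) (deg : ι → ℤ) (g : ℤ) : Submodule F A :=
  Submodule.span F {m | ∃ l : List ι, (l.map deg).sum = g ∧ m = (l.map v).prod}

/-! ### The Grassmann algebra and its induced gradings -/

/-- The Grassmann algebra `E` of the vector space `L` with countable basis `e₀, e₁, e₂, …`. -/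
abbrev Grassmann (F : Type*) [Field F] : Type _ := ExteriorAlgebra F (ℕ →₀ F)

/-- The generator `eᵢ` of the Grassmann algebra. -/
noncomputable def gen (F : Type*) [Field F] (i : ℕ) : Grassmann F :=
  ExteriorAlgebra.ι F (Finsupp.single i (1 : F))

/-- The function `δ`, read as an assignment of degrees to the generators `e₀, e₁, …`, takes only
the values `r₁ < ⋯ < rₙ`, and it takes the value `rⱼ` on exactly `vⱼ` generators (`vⱼ` may be
infinite). -/
def IsInduced {n : ℕ} (r : Fin n → ℤ) (v : Fin n → ℕ∞) (δ : ℕ → ℤ) : Prop :=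
  StrictMono r ∧ (∀ i, ∃ j, δ i = r j) ∧ ∀ j, {i : ℕ | δ i = r j}.encard = v j

/-- The component of degree `g` of the grading on `E` determined by `‖eᵢ‖ = δ i`. When
`IsInduced r v δ` holds, this is the `n`-induced grading `E_{(r₁,…,rₙ)}^{(v₁,…,vₙ)}`. -/
noncomputable def grassmannComponent (F : Type*) [Field F] (δ : ℕ → ℤ) :
    ℤ → Submodule F (Grassmann F) :=
  monomialComponent F (gen F) δ

/-! ### Graded polynomials, graded identities, and ideals stable under graded endomorphisms -/

/-- The free unital associative `ℤ`-graded algebra; the variable indexed by `(g, i)` is the `i`-th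
variable of degree `g`. -/
abbrev FreeGraded (F : Type*) [Field F] : Type _ := FreeAlgebra F (ℤ × ℕ)

/-- The variable indexed by `p = (g, i)`; its degree is `g = p.1`. -/
def var (F : Type*) [Field F] (p : ℤ × ℕ) : FreeGraded F := FreeAlgebra.ι F p

/-- The component of degree `g` of the free graded algebra. -/
def freeComponent (F : Type*) [Field F] : ℤ → Submodule F (FreeGraded F) :=
  monomialComponent F (var F) Prod.fst

/-- `f` is a graded identity of the algebra `A` with homogeneous components `𝒜 g`: every
substitution of elements of `𝒜 g` for the variables of degree `g` annihilates `f`. -/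
def IsGradedIdentity {F : Type*} [Field F] {A : Type*} [Ring A] [Algebra F A]
    (𝒜 : ℤ → Submodule F A) (f : FreeGraded F) : Prop :=
  ∀ s : ℤ × ℕ → A, (∀ p, s p ∈ 𝒜 p.1) → FreeAlgebra.lift F s f = 0

/-- The two-sided ideal `T_ℤ(A)` of all graded identities of `A`. -/
def gradedIdentities {F : Type*} [Field F] {A : Type*} [Ring A] [Algebra F A]
    (𝒜 : ℤ → Submodule F A) : TwoSidedIdeal (FreeGraded F) :=
  TwoSidedIdeal.mk' {f | IsGradedIdentity 𝒜 f}
    (fun s _ => map_zero _)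
    (fun hx hy s hs => by rw [map_add, hx s hs, hy s hs, add_zero])
    (fun hx s hs => by rw [map_neg, hx s hs, neg_zero])
    (fun hy s hs => by rw [map_mul, hy s hs, mul_zero])
    (fun hx s hs => by rw [map_mul, hx s hs, zero_mul])

/-- `I` is a `T_ℤ`-ideal: it is invariant under all graded endomorphisms of the free graded
algebra. -/
def IsTIdeal {F : Type*} [Field F] (I : TwoSidedIdeal (FreeGraded F)) : Prop :=
  ∀ φ : FreeGraded F →ₐ[F] FreeGraded F,
    (∀ g, ∀ f ∈ freeComponent F g, φ f ∈ freeComponent F g) → ∀ f ∈ I, φ f ∈ I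

/-- The `T_ℤ`-ideal generated by `S`: the least `T_ℤ`-ideal containing `S`. -/
def tIdealSpan {F : Type*} [Field F] (S : Set (FreeGraded F)) : TwoSidedIdeal (FreeGraded F) :=
  sInf {I | IsTIdeal I ∧ S ⊆ {f | f ∈ I}}

/-! ### The arithmetic condition and the generating polynomials -/

/-- The condition `B̂` on `{a, b, c}`. -/
def ConditionBHat (a b c : ℤ) : Prop :=
  Int.gcd (Int.gcd a b) c = 1 ∧ Int.gcd a b ≠ 1 ∧ Int.gcd a c ≠ 1 ∧ Int.gcd b c ≠ 1

/-- The polynomials `[x₁, x₂, x₃] = [[x₁, x₂], x₃]` in distinct variables of arbitrary degrees. -/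
def tripleCommutators (F : Type*) [Field F] : Set (FreeGraded F) :=
  {f | ∃ x : Fin 3 → ℤ × ℕ, Function.Injective x ∧
    f = ⁅⁅var F (x 0), var F (x 1)⁆, var F (x 2)⁆}

/-- The monomials `u₁ u₂ ⋯ u_α` in distinct variables, none of degree divisible by `d`, such that
`‖uᵢ‖ = qᵢ d + rᵢ c` with `1 ≤ rᵢ ≤ d - 1` and `r₁ + ⋯ + r_α > k`. -/
def longProducts (F : Type*) [Field F] (d : ℕ) (c : ℤ) (k : ℕ) : Set (FreeGraded F) :=
  {f | ∃ (α : ℕ) (u : Fin α → ℤ × ℕ) (q : Fin α → ℤ) (r : Fin α → ℕ),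
    Function.Injective u ∧
    (∀ i, ¬ (d : ℤ) ∣ (u i).1 ∧ (u i).1 = q i * d + r i * c ∧ 1 ≤ r i ∧ r i ≤ d - 1) ∧
    k < ∑ i, r i ∧
    f = (List.ofFn fun i => var F (u i)).prod}

end GradedGrassmann

/-! Since `d` divides `a` and `b` and is prime to `c`, the degree of a monomial of `E` fixes, modulo
`d`, how many generators of degree `c` it contains. Elements of degree `g` therefore lie in the span
of monomials with at least `degResidue d c g` such generators. Only `k` of them exist, so products
with residue sum above `k` vanish. Commutators of `E` are central, and the easy inclusion follows.

Conversely, let `I` be a `T`-ideal containing the generating polynomials and `f` a graded identity.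
In characteristic zero it suffices to kill every polarization of `f` in the quotient by `I`
(`sum_words_eq_zero`). If the residues of the letters add up to more than `k`, each word is already
in `I`: letters of residue zero are absorbed into neighbouring ones (`word_mem_of_lt_sum`).

Otherwise there are enough generators of degree `c` to choose, for any prescribed parities,
monomials of `E` with disjoint supports and the degrees of the letters (`exists_monomials`). The
evenness of `(a/d)(b/d)` makes both parities available in each degree. Substituting sums of these
monomials into `f` and extracting the multilinear part shows that the polarization vanishes under
every parity pattern (`sum_perm_paritySubst_eq_zero`). In any algebra with central commutators this
forces a multilinear element to be zero (`eq_zero_of_paritySubst`), and the quotient by `I` is such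
an algebra. -/

namespace GradedGrassmann

/-! ### Rings with central commutators -/

/-- All commutators of the ring `Q` are central. -/
def CentralCommutators (Q : Type*) [Ring Q] : Prop :=
  ∀ u v w : Q, ⁅⁅u, v⁆, w⁆ = 0

namespace CentralCommutators

variable {Q : Type*} [Ring Q]

theorem mul_lie_comm (hQ : CentralCommutators Q) (u v w : Q) : w * ⁅u, v⁆ = ⁅u, v⁆ * w := by
  have := hQ u v w
  rw [Ring.lie_def ⁅u, v⁆, sub_eq_zero] at this
  exact this.symm

/-- Expand `⁅⁅a, b * c⁆, e⁆ = 0` by the Leibniz rule: only two products of commutators survive. -/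
theorem lie_mul_lie (hQ : CentralCommutators Q) (a b c e : Q) :
    ⁅a, b⁆ * ⁅c, e⁆ = -(⁅a, c⁆ * ⁅b, e⁆) := by
  have h1 : ⁅a, b * c⁆ = ⁅a, b⁆ * c + b * ⁅a, c⁆ := by
    simp only [Ring.lie_def]; noncomm_ring
  have h2 : ⁅⁅a, b * c⁆, e⁆ =
      ⁅⁅a, b⁆, e⁆ * c + ⁅a, b⁆ * ⁅c, e⁆ + (⁅b, e⁆ * ⁅a, c⁆ + b * ⁅⁅a, c⁆, e⁆) := by
    rw [h1]; simp only [Ring.lie_def]; noncomm_ring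
  rw [hQ, hQ, hQ, zero_mul, mul_zero, zero_add, add_zero,
    hQ.mul_lie_comm a c] at h2
  exact eq_neg_of_add_eq_zero_left h2.symm

theorem prod {R : Type*} [Ring R] (hQ : CentralCommutators Q) (hR : CentralCommutators R) :
    CentralCommutators (Q × R) := fun u v w => by
  ext
  · exact hQ u.1 v.1 w.1
  · exact hR u.2 v.2 w.2

theorem pi {I : Type*} {R : I → Type*} [∀ i, Ring (R i)] (h : ∀ i, CentralCommutators (R i)) :
    CentralCommutators (∀ i, R i) := fun u v w => by
  ext i
  exact h i (u i) (v i) (w i)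

theorem of_span {F : Type*} [Field F] [Algebra F Q] {s : Set Q} (hs : Submodule.span F s = ⊤)
    (h : ∀ a ∈ s, ∀ b ∈ s, ∀ c ∈ s, ⁅⁅a, b⁆, c⁆ = 0) : CentralCommutators Q := by
  have key : ∀ q : Q, q ∈ Submodule.span F s := fun q => hs ▸ Submodule.mem_top
  intro u v w
  simp only [Ring.lie_def] at *
  induction key u using Submodule.span_induction with
  | zero => simp
  | smul c a _ ha => simp only [smul_mul_assoc, mul_smul_comm, ← smul_sub, ha, smul_zero]
  | add a b _ _ ha hb => rw [← add_zero 0]; nth_rw 1 [← ha]; rw [← hb]; noncomm_ring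
  | mem a ha =>
  induction key v using Submodule.span_induction with
  | zero => simp
  | smul c a _ ha => simp only [smul_mul_assoc, mul_smul_comm, ← smul_sub, ha, smul_zero]
  | add a b _ _ ha hb => rw [← add_zero 0]; nth_rw 1 [← ha]; rw [← hb]; noncomm_ring
  | mem b hb =>
  induction key w using Submodule.span_induction with
  | zero => simp
  | smul c a _ ha => simp only [smul_mul_assoc, mul_smul_comm, ← smul_sub, ha, smul_zero]
  | add a b _ _ ha hb => rw [← add_zero 0]; nth_rw 1 [← ha]; rw [← hb]; noncomm_ring
  | mem c hc => exact h a ha b hb c hc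

end CentralCommutators

/-! ### Multilinear elements -/

section Multilinear

variable {F : Type*} [Field F] {V : Type*} [DecidableEq V] {Q : Type*} [Ring Q] [Algebra F Q]

/-- The span of the products of the elements `x v`, `v ∈ S`, each taken once, in any order. -/
def multilinearSpan (F : Type*) [Field F] {V : Type*} [DecidableEq V] {Q : Type*} [Ring Q]
    [Algebra F Q] (x : V → Q) (S : Finset V) : Submodule F Q :=
  Submodule.span F {m | ∃ l : List V, l.Nodup ∧ l.toFinset = S ∧ m = (l.map x).prod}

theorem prod_mem_multilinearSpan (x : V → Q) {l : List V} (hl : l.Nodup) :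
    (l.map x).prod ∈ multilinearSpan F x l.toFinset :=
  Submodule.subset_span ⟨l, hl, rfl, rfl⟩

theorem mul_mem_multilinearSpan {x : V → Q} {S : Finset V} {v : V} (hv : v ∉ S) {g : Q}
    (hg : g ∈ multilinearSpan F x S) : x v * g ∈ multilinearSpan F x (insert v S) := by
  induction hg using Submodule.span_induction with
  | mem m hm =>
    obtain ⟨l, hl, rfl, rfl⟩ := hm
    refine Submodule.subset_span ⟨v :: l, List.nodup_cons.2 ⟨by simpa using hv, hl⟩, ?_, ?_⟩ <;>
      simp
  | zero => simp
  | add a b _ _ ha hb => rw [mul_add]; exact add_mem ha hb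
  | smul c a _ ha => rw [mul_smul_comm]; exact Submodule.smul_mem _ _ ha

theorem lie_mul_mem_multilinearSpan {x : V → Q} {S : Finset V} {v w : V} (hv : v ∉ S) (hw : w ∉ S)
    (hvw : v ≠ w) {g : Q} (hg : g ∈ multilinearSpan F x S) :
    ⁅x v, x w⁆ * g ∈ multilinearSpan F x (insert v (insert w S)) := by
  rw [Ring.lie_def, sub_mul, mul_assoc, mul_assoc]
  refine sub_mem (mul_mem_multilinearSpan (by simp [hvw, hv]) (mul_mem_multilinearSpan hw hg)) ?_
  rw [Finset.insert_comm]
  exact mul_mem_multilinearSpan (by simp [hvw.symm, hw]) (mul_mem_multilinearSpan hv hg)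

/-- `q` is the sum of `x v * g` and of terms `⁅x v, x j⁆ * h j`, with `g` and `h j` multilinear
in the remaining variables. -/
def SplitsOff (F : Type*) [Field F] {V : Type*} [DecidableEq V] {Q : Type*} [Ring Q]
    [Algebra F Q] (x : V → Q) (S : Finset V) (v : V) (q : Q) : Prop :=
  ∃ g ∈ multilinearSpan F x (S.erase v), ∃ h : V → Q,
    (∀ j ∈ S.erase v, h j ∈ multilinearSpan F x ((S.erase v).erase j)) ∧
    q = x v * g + ∑ j ∈ S.erase v, ⁅x v, x j⁆ * h j

theorem splitsOff_prod (hQ : CentralCommutators Q) (x : V → Q) (v : V) :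
    ∀ l : List V, l.Nodup → v ∈ l → SplitsOff F x l.toFinset v (l.map x).prod
  | [], _, h => by simp at h
  | z :: t, hl, hv => by
    obtain ⟨hz, ht⟩ := List.nodup_cons.1 hl
    by_cases hzv : z = v
    · subst hzv
      have he : (z :: t).toFinset.erase z = t.toFinset := by
        rw [List.toFinset_cons, Finset.erase_insert (by simpa using hz)]
      refine ⟨(t.map x).prod, by rw [he]; exact prod_mem_multilinearSpan x ht, 0, ?_, by simp⟩
      simp
    · have hvt : v ∈ t := by simpa [Ne.symm hzv] using hv
      obtain ⟨g, hg, h, hh, e⟩ := splitsOff_prod hQ x v t ht hvt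
      have hzt : z ∉ t.toFinset.erase v := by simp [hz]
      have he : (z :: t).toFinset.erase v = insert z (t.toFinset.erase v) := by
        rw [List.toFinset_cons, Finset.erase_insert_of_ne hzv]
      -- Moving `x v` left past `x z` turns `x z * x v * g` into `x v * (x z * g) - ⁅x v, x z⁆ * g`;
      -- the commutators already present are central.
      refine ⟨x z * g, by rw [he]; exact mul_mem_multilinearSpan hzt hg,
        fun j => if j = z then -g else x z * h j, ?_, ?_⟩
      · rw [he]
        intro j hj
        by_cases hjz : j = z
        · subst hjz
          simp only [if_true]
          rw [Finset.erase_insert hzt]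
          exact neg_mem hg
        · simp only [if_neg hjz]
          rw [Finset.erase_insert_of_ne (Ne.symm hjz)]
          refine mul_mem_multilinearSpan (fun h' => hzt (Finset.mem_of_mem_erase h')) (hh j ?_)
          exact Finset.mem_of_mem_insert_of_ne hj hjz
      · rw [he, Finset.sum_insert hzt, List.map_cons, List.prod_cons, e, mul_add,
          Finset.mul_sum, ← add_assoc]
        simp only [if_true]
        congr 1
        · simp only [Ring.lie_def]; noncomm_ring
        · refine Finset.sum_congr rfl fun j hj => ?_
          have hjz : j ≠ z := fun h' => hzt (h' ▸ hj)
          simp only [if_neg hjz]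
          rw [← mul_assoc, hQ.mul_lie_comm, mul_assoc]

theorem splitsOff_of_mem (hQ : CentralCommutators Q) (x : V → Q) {S : Finset V} {v : V}
    (hv : v ∈ S) {q : Q} (hq : q ∈ multilinearSpan F x S) : SplitsOff F x S v q := by
  induction hq using Submodule.span_induction with
  | mem m hm =>
    obtain ⟨l, hl, rfl, rfl⟩ := hm
    exact splitsOff_prod hQ x v l hl (by simpa using hv)
  | zero => exact ⟨0, zero_mem _, 0, fun j _ => zero_mem _, by simp⟩
  | add a b _ _ ha hb =>
    obtain ⟨g, hg, h, hh, e⟩ := ha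
    obtain ⟨g', hg', h', hh', e'⟩ := hb
    refine ⟨g + g', add_mem hg hg', h + h', fun j hj => add_mem (hh j hj) (hh' j hj), ?_⟩
    rw [e, e']
    simp only [Pi.add_apply, mul_add, Finset.sum_add_distrib]
    abel
  | smul c a _ ha =>
    obtain ⟨g, hg, h, hh, e⟩ := ha
    refine ⟨c • g, Submodule.smul_mem _ _ hg, c • h, fun j hj => Submodule.smul_mem _ _ (hh j hj),
      ?_⟩
    rw [e]
    simp only [Pi.smul_apply, mul_smul_comm, smul_add, Finset.smul_sum]

end Multilinear

/-! ### Products of generators of the exterior algebra -/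

section Exterior

variable {F : Type*} [Field F] {V : Type*}

/-- The generator of the exterior algebra on the basis `V` indexed by `v`. -/
noncomputable def extGen (F : Type*) [Field F] {V : Type*} (v : V) : ExteriorAlgebra F (V →₀ F) :=
  ExteriorAlgebra.ι F (Finsupp.single v (1 : F))

/-- The product of the generators listed in `l`. -/
noncomputable def extMon (F : Type*) [Field F] {V : Type*} (l : List V) :
    ExteriorAlgebra F (V →₀ F) :=
  (l.map (extGen F)).prod

theorem extMon_nil : extMon F ([] : List V) = 1 := rfl

theorem extMon_cons (v : V) (l : List V) : extMon F (v :: l) = extGen F v * extMon F l := by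
  simp [extMon]

theorem extMon_append (l l' : List V) : extMon F (l ++ l') = extMon F l * extMon F l' := by
  simp [extMon]

theorem extGen_mul_extGen (v w : V) : extGen F v * extGen F w = -(extGen F w * extGen F v) :=
  eq_neg_of_add_eq_zero_left (ExteriorAlgebra.ι_add_mul_swap _ _)

theorem extGen_mul_extMon (v : V) (l : List V) :
    extGen F v * extMon F l = (-1 : F) ^ l.length • (extMon F l * extGen F v) := by
  induction l with
  | nil => simp [extMon_nil]
  | cons w l ih =>
    rw [extMon_cons, ← mul_assoc, extGen_mul_extGen, neg_mul, mul_assoc, ih, List.length_cons,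
      pow_succ, mul_smul_comm, mul_assoc]
    simp

theorem extMon_mul_extMon (l l' : List V) :
    extMon F l * extMon F l' = (-1 : F) ^ (l.length * l'.length) • (extMon F l' * extMon F l) := by
  induction l with
  | nil => simp [extMon_nil]
  | cons w l ih =>
    rw [extMon_cons, mul_assoc, ih, mul_smul_comm, ← mul_assoc, extGen_mul_extMon, smul_mul_assoc,
      smul_smul, mul_assoc, ← pow_add, List.length_cons, add_mul, one_mul]

theorem span_extMon : Submodule.span F (Set.range (extMon F (V := V))) = ⊤ := by
  rw [eq_top_iff]
  rintro q -
  induction q using ExteriorAlgebra.induction with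
  | algebraMap r =>
    rw [Algebra.algebraMap_eq_smul_one, ← extMon_nil (V := V)]
    exact Submodule.smul_mem _ _ (Submodule.subset_span ⟨_, rfl⟩)
  | ι x =>
    induction x using Finsupp.induction_linear with
    | zero => simp
    | add f g hf hg => rw [map_add]; exact add_mem hf hg
    | single v c =>
      have : ExteriorAlgebra.ι F (Finsupp.single v c) = c • extMon F [v] := by
        rw [extMon_cons, extMon_nil, mul_one, extGen, ← map_smul, Finsupp.smul_single_one]
      rw [this]
      exact Submodule.smul_mem _ _ (Submodule.subset_span ⟨_, rfl⟩)
  | mul a b ha hb =>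
    have := Submodule.mul_mem_mul ha hb
    rw [Submodule.span_mul_span] at this
    refine Submodule.span_mono ?_ this
    rintro _ ⟨_, ⟨l, rfl⟩, _, ⟨l', rfl⟩, rfl⟩
    exact ⟨l ++ l', extMon_append l l'⟩
  | add a b ha hb => exact add_mem ha hb

/-- Either the first two monomials commute, or both are odd and their commutator is a multiple of a
monomial of even length, which is central. -/
theorem lie_lie_extMon (l₁ l₂ l₃ : List V) :
    ⁅⁅extMon F l₁, extMon F l₂⁆, extMon F l₃⁆ = 0 := by
  simp only [Ring.lie_def]
  rcases Nat.even_or_odd (l₁.length * l₂.length) with h | h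
  · rw [extMon_mul_extMon l₁, h.neg_one_pow, one_smul, sub_self]; simp
  · have h1 : extMon F l₁ * extMon F l₂ = - (extMon F l₂ * extMon F l₁) := by
      rw [extMon_mul_extMon l₁, h.neg_one_pow]; simp
    have h2 : Even ((l₂ ++ l₁).length * l₃.length) := by
      rw [Nat.odd_mul] at h
      rw [List.length_append]
      exact (h.2.add_odd h.1).mul_right _
    have h3 := extMon_mul_extMon (F := F) (l₂ ++ l₁) l₃
    rw [h2.neg_one_pow, one_smul, extMon_append] at h3
    rw [h1, sub_mul, mul_sub, neg_mul, mul_neg, h3]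
    simp

theorem centralCommutators_exterior (F : Type*) [Field F] (V : Type*) :
    CentralCommutators (ExteriorAlgebra F (V →₀ F)) := by
  refine .of_span (F := F) span_extMon ?_
  rintro _ ⟨l₁, rfl⟩ _ ⟨l₂, rfl⟩ _ ⟨l₃, rfl⟩
  exact lie_lie_extMon l₁ l₂ l₃

/-- Contraction with the coordinate function of `v`. -/
noncomputable def coordContract (F : Type*) [Field F] {V : Type*} (v : V) :
    ExteriorAlgebra F (V →₀ F) →ₗ[F] ExteriorAlgebra F (V →₀ F) :=
  CliffordAlgebra.contractLeft (Q := 0) (Finsupp.lapply v)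

theorem coordContract_one (v : V) : coordContract F v 1 = 0 :=
  CliffordAlgebra.contractLeft_one _ _

theorem coordContract_mul (v w : V) (q : ExteriorAlgebra F (V →₀ F)) :
    coordContract F v (extGen F w * q) =
      Finsupp.single w (1 : F) v • q - extGen F w * coordContract F v q :=
  CliffordAlgebra.contractLeft_ι_mul (Q := 0) _ _ _

theorem coordContract_mul_self (v : V) (q : ExteriorAlgebra F (V →₀ F)) :
    coordContract F v (extGen F v * q) = q - extGen F v * coordContract F v q := by
  rw [coordContract_mul, Finsupp.single_eq_same, one_smul]

theorem coordContract_mul_of_ne {v w : V} (h : v ≠ w) (q : ExteriorAlgebra F (V →₀ F)) :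
    coordContract F v (extGen F w * q) = - (extGen F w * coordContract F v q) := by
  rw [coordContract_mul, Finsupp.single_eq_of_ne h, zero_smul, zero_sub]

theorem coordContract_extMon {v : V} {l : List V} (h : v ∉ l) :
    coordContract F v (extMon F l) = 0 := by
  induction l with
  | nil => exact coordContract_one v
  | cons w l ih =>
    rw [List.mem_cons, not_or] at h
    rw [extMon_cons, coordContract_mul_of_ne h.1, ih h.2]; simp

/-- Contraction with the leading generator strips it off, which reduces to the monomial `1`. -/
theorem extMon_ne_zero {l : List V} (h : l.Nodup) : extMon F l ≠ 0 := by
  induction l with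
  | nil => exact one_ne_zero
  | cons w l ih =>
    obtain ⟨h1, h2⟩ := List.nodup_cons.1 h
    intro h0
    have := coordContract_mul_self (F := F) w (extMon F l)
    rw [coordContract_extMon h1, ← extMon_cons, h0] at this
    exact ih h2 (by simpa using this.symm)

theorem extGen_mul_self (v : V) : extGen F v * extGen F v = 0 := ExteriorAlgebra.ι_sq_zero _

theorem extGen_mul_extMon_of_mem {v : V} {l : List V} (h : v ∈ l) :
    extGen F v * extMon F l = 0 := by
  obtain ⟨s, t, rfl⟩ := List.append_of_mem h
  rw [extMon_append, ← mul_assoc, extGen_mul_extMon, extMon_cons, smul_mul_assoc, mul_assoc,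
    ← mul_assoc (extGen F v), extGen_mul_self]
  simp

theorem extMon_eq_zero {l : List V} (h : ¬ l.Nodup) : extMon F l = 0 := by
  induction l with
  | nil => simp at h
  | cons w l ih =>
    rw [extMon_cons]
    by_cases hw : w ∈ l
    · exact extGen_mul_extMon_of_mem hw
    · rw [ih (fun h' => h (List.nodup_cons.2 ⟨hw, h'⟩)), mul_zero]

theorem eq_zero_of_extGen_mul {v : V} {q : ExteriorAlgebra F (V →₀ F)}
    (hq : coordContract F v q = 0) (h : extGen F v * q = 0) : q = 0 := by
  have := coordContract_mul_self v q
  rw [h, hq] at this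
  simpa using this.symm

end Exterior

/-! ### Multilinear elements are detected by exterior algebras -/

section Detection

variable {F : Type*} [Field F] {V : Type*} [DecidableEq V]
  {Q : Type*} [Ring Q] [Algebra F Q]

/-- The element of the exterior algebra substituted for `v`: odd if `v ∈ J` and even otherwise. -/
noncomputable def paritySubst (F : Type*) [Field F] {V : Type*} [DecidableEq V] (J : Finset V)
    (v : V) : ExteriorAlgebra F (V →₀ F) :=
  if v ∈ J then extGen F v else 1

theorem map_prod_paritySubst {x : V → Q} {J : Finset V}
    {τ : Q →ₐ[F] ExteriorAlgebra F (V →₀ F)} (hτ : ∀ v, τ (x v) = paritySubst F J v) (l : List V) :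
    τ (l.map x).prod = (l.map (paritySubst F J)).prod := by
  rw [map_list_prod, List.map_map]
  congr 1
  exact List.map_congr_left fun v _ => hτ v

/-- Allows the parities of variables absent from `q` to be changed freely. -/
theorem apply_eq_of_parity_agree {x : V → Q} {S J J' : Finset V} (hJ : ∀ v ∈ S, v ∈ J ↔ v ∈ J')
    {τ τ' : Q →ₐ[F] ExteriorAlgebra F (V →₀ F)} (hτ : ∀ v, τ (x v) = paritySubst F J v)
    (hτ' : ∀ v, τ' (x v) = paritySubst F J' v) {q : Q} (hq : q ∈ multilinearSpan F x S) :
    τ q = τ' q := by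
  induction hq using Submodule.span_induction with
  | mem m hm =>
    obtain ⟨l, hl, rfl, rfl⟩ := hm
    rw [map_prod_paritySubst hτ, map_prod_paritySubst hτ']
    congr 1
    refine List.map_congr_left fun v hv => ?_
    simp only [paritySubst, hJ v (by simpa using hv)]
  | zero => simp
  | add a b _ _ ha hb => simp [ha, hb]
  | smul c a _ ha => simp [ha]

theorem coordContract_apply_eq_zero {x : V → Q} {S J : Finset V} {w : V} (hw : w ∉ S)
    {τ : Q →ₐ[F] ExteriorAlgebra F (V →₀ F)} (hτ : ∀ v, τ (x v) = paritySubst F J v)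
    {q : Q} (hq : q ∈ multilinearSpan F x S) : coordContract F w (τ q) = 0 := by
  induction hq using Submodule.span_induction with
  | mem m hm =>
    obtain ⟨l, hl, rfl, rfl⟩ := hm
    rw [map_prod_paritySubst hτ]
    have hwl : w ∉ l := by simpa using hw
    clear hw hl
    induction l with
    | nil => exact coordContract_one w
    | cons v l ih =>
      rw [List.mem_cons, not_or] at hwl
      rw [List.map_cons, List.prod_cons, paritySubst]
      split_ifs
      · rw [coordContract_mul_of_ne hwl.1, ih hwl.2]; simp
      · rw [one_mul, ih hwl.2]
  | zero => simp
  | add a b _ _ ha hb => simp [ha, hb]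
  | smul c a _ ha => simp [ha]

/-- A multilinear element which vanishes under all substitutions of prescribed parities is zero. -/
theorem eq_zero_of_paritySubst [CharZero F] (hQ : CentralCommutators Q) (x : V → Q)
    (τ : Finset V → Q →ₐ[F] ExteriorAlgebra F (V →₀ F))
    (hτ : ∀ J v, τ J (x v) = paritySubst F J v) :
    ∀ (n : ℕ) (S : Finset V), S.card = n → ∀ q ∈ multilinearSpan F x S,
      (∀ J ⊆ S, τ J q = 0) → q = 0 := by
  have hodd : ∀ {J v}, v ∈ J → τ J (x v) = extGen F v := fun h => by
    rw [hτ, paritySubst, if_pos h]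
  have heven : ∀ {J v}, v ∉ J → τ J (x v) = 1 := fun h => by
    rw [hτ, paritySubst, if_neg h]
  have hlie : ∀ {J v} (w), v ∉ J → τ J ⁅x v, x w⁆ = 0 := fun w h => by
    rw [Ring.lie_def, map_sub, map_mul, map_mul, heven h]; simp
  have hsum : ∀ {J v} (T : Finset V) (h : V → Q), v ∉ J →
      τ J (∑ j ∈ T, ⁅x v, x j⁆ * h j) = 0 := fun T h hv => by
    rw [map_sum]
    exact Finset.sum_eq_zero fun j _ => by rw [map_mul, hlie j hv, zero_mul]
  intro n
  induction n using Nat.strong_induction_on with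
  | _ n ih =>
  intro S hS q hq hJ
  rcases S.eq_empty_or_nonempty with rfl | ⟨v, hv⟩
  · have h1 : ∃ c : F, q = algebraMap F Q c := by
      clear hJ
      induction hq using Submodule.span_induction with
      | mem m hm =>
        obtain ⟨l, _, hl, rfl⟩ := hm
        rw [List.toFinset_eq_empty_iff] at hl
        exact ⟨1, by simp [hl]⟩
      | zero => exact ⟨0, by simp⟩
      | add a b _ _ ha hb =>
        obtain ⟨r, rfl⟩ := ha
        obtain ⟨s, rfl⟩ := hb
        exact ⟨r + s, by simp⟩
      | smul r a _ ha =>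
        obtain ⟨s, rfl⟩ := ha
        exact ⟨r * s, by rw [map_mul, ← Algebra.smul_def]⟩
    obtain ⟨c, rfl⟩ := h1
    have := hJ ∅ subset_rfl
    rw [AlgHom.commutes, ExteriorAlgebra.algebraMap_eq_zero_iff] at this
    rw [this, map_zero]
  have hcard : (S.erase v).card < n := by rw [← hS]; exact Finset.card_erase_lt_of_mem hv
  obtain ⟨g, hg, h, hh, e⟩ := splitsOff_of_mem hQ x hv hq
  have hg0 : g = 0 := by
    -- With `v` even, `x v` is sent to `1` and every commutator with it to `0`, so only `g` remains.
    refine ih _ hcard _ rfl g hg fun J hJS => ?_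
    have hvJ : v ∉ J := fun h' => by simpa using hJS h'
    have := hJ J (hJS.trans (Finset.erase_subset _ _))
    rwa [e, map_add, hsum _ _ hvJ, add_zero, map_mul, heven hvJ, one_mul] at this
  rw [hg0, mul_zero, zero_add] at e
  rcases (S.erase v).eq_empty_or_nonempty with h0 | ⟨w, hw⟩
  · rw [e, h0, Finset.sum_empty]
  have hwv : w ≠ v := Finset.ne_of_mem_erase hw
  have hwS : w ∈ S := Finset.mem_of_mem_erase hw
  set T := (S.erase v).erase w with hT
  have hvT : v ∉ T := by simp [hT]
  have hwT : w ∉ T := by simp [hT]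
  have hsplit : ∀ j, j ∈ T → SplitsOff F x ((S.erase v).erase j) w (h j) := fun j hj =>
    splitsOff_of_mem hQ x (Finset.mem_erase.2 ⟨(Finset.ne_of_mem_erase hj).symm, hw⟩)
      (hh j (Finset.mem_of_mem_erase hj))
  choose! g' hg' h' hh' e' using hsplit
  have hTj : ∀ j, ((S.erase v).erase j).erase w = T.erase j := fun j => by
    rw [hT, Finset.erase_right_comm]
  simp only [hTj] at hg' hh' e'
  have hins : insert w T = S.erase v := Finset.insert_erase hw
  have hSw : insert v T = S.erase w := by
    rw [hT, Finset.erase_right_comm, Finset.insert_erase (Finset.mem_erase.2 ⟨hwv.symm, hv⟩)]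
  have hcardT : T.card < n := lt_of_le_of_lt (Finset.card_le_card (Finset.erase_subset _ _)) hcard
  set G := ∑ j ∈ T, ⁅x v, x j⁆ * g' j with hG
  set H := h w - ∑ j ∈ T, ∑ l ∈ T.erase j, ⁅x j, x l⁆ * h' j l with hH
  -- After `w` is split off from each `h j`, the identity `lie_mul_lie` rewrites `⁅x v, x j⁆ * ⁅x w,
  -- x l⁆` as `-⁅x v, x w⁆ * ⁅x j, x l⁆`, which exposes a single common commutator.
  have eq1 : q = x w * G + ⁅x v, x w⁆ * H := by
    rw [e, ← hins, Finset.sum_insert hwT, hG, hH, mul_sub, Finset.mul_sum, Finset.mul_sum,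
      add_sub_left_comm, ← add_sub_assoc, add_sub_assoc, ← Finset.sum_sub_distrib]
    congr 1
    refine Finset.sum_congr rfl fun j hj => ?_
    rw [e' j hj, mul_add, Finset.mul_sum, Finset.mul_sum, sub_eq_add_neg, ← Finset.sum_neg_distrib]
    congr 1
    · rw [← mul_assoc, ← mul_assoc, hQ.mul_lie_comm]
    · refine Finset.sum_congr rfl fun l _ => ?_
      rw [← mul_assoc, ← mul_assoc, hQ.lie_mul_lie, neg_mul]
  have hGm : G ∈ multilinearSpan F x (S.erase w) := by
    refine sum_mem fun j hj => ?_
    have := lie_mul_mem_multilinearSpan (v := v) (w := j)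
      (fun h => hvT (Finset.mem_of_mem_erase h)) (Finset.notMem_erase j T)
      (fun h => hvT (h ▸ hj)) (hg' j hj)
    rwa [Finset.insert_erase hj, hSw] at this
  have hHm : H ∈ multilinearSpan F x T := by
    refine sub_mem (hh w hw) (sum_mem fun j hj => sum_mem fun l hl => ?_)
    have := lie_mul_mem_multilinearSpan (v := j) (w := l)
      (fun h => Finset.notMem_erase j T (Finset.mem_of_mem_erase h)) (Finset.notMem_erase l _)
      (Finset.ne_of_mem_erase hl).symm (hh' j hj l hl)
    rwa [Finset.insert_erase hl, Finset.insert_erase hj] at this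
  have hlie' : ∀ {J}, w ∉ J → τ J ⁅x v, x w⁆ = 0 := fun h => by
    rw [Ring.lie_def, map_sub, map_mul, map_mul, heven h]; simp
  have hG0 : G = 0 := by
    refine ih _ (by rw [← hS]; exact Finset.card_erase_lt_of_mem hwS) _ rfl G hGm fun J hJS => ?_
    have hwJ : w ∉ J := fun h' => by simpa using hJS h'
    have := hJ J (hJS.trans (Finset.erase_subset _ _))
    rwa [eq1, map_add, map_mul, map_mul, hlie' hwJ, zero_mul, add_zero, heven hwJ, one_mul] at this
  have hH0 : H = 0 := by
    refine ih _ hcardT _ rfl H hHm fun J hJT => ?_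
    -- Making `v` and `w` odd does not affect `H`, and it sends `⁅x v, x w⁆` to twice the product of
    -- two generators.
    set J' := insert v (insert w J) with hJ'
    have hvJ' : v ∈ J' := by simp [hJ']
    have hwJ' : w ∈ J' := by simp [hJ']
    have hagree : ∀ u ∈ T, u ∈ J ↔ u ∈ J' := fun u hu => by
      have h1 : u ≠ v := fun h => hvT (h ▸ hu)
      have h2 : u ≠ w := fun h => hwT (h ▸ hu)
      simp [hJ', h1, h2]
    rw [apply_eq_of_parity_agree hagree (hτ J) (hτ J') hHm]
    have h0 := hJ J' (by
      rw [hJ', Finset.insert_subset_iff, Finset.insert_subset_iff]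
      exact ⟨hv, hwS, hJT.trans ((Finset.erase_subset _ _).trans (Finset.erase_subset _ _))⟩)
    rw [eq1, hG0, mul_zero, zero_add, map_mul, Ring.lie_def, map_sub, map_mul, map_mul, hodd hvJ',
      hodd hwJ', extGen_mul_extGen w v, sub_neg_eq_add, ← two_smul F, smul_mul_assoc,
      smul_eq_zero_iff_right two_ne_zero, mul_assoc] at h0
    -- The factor `2` is now cancelled. As the image of `H` involves neither generator, contraction
    -- removes them both.
    have hc : ∀ {u}, u ∉ T → coordContract F u (τ J' H) = 0 := fun hu =>
      coordContract_apply_eq_zero hu (hτ J') hHm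
    refine eq_zero_of_extGen_mul (hc hwT) (eq_zero_of_extGen_mul ?_ h0)
    rw [coordContract_mul_of_ne hwv.symm, hc hvT]; simp
  rw [eq1, hG0, hH0]; simp

end Detection


/-! ### Extracting the multilinear part of a substitution -/

section Polarization

variable {F : Type*} [Field F] {X : Type*} [DecidableEq X] {V : Type*} [DecidableEq V]
  {A : Type*} [Ring A] [Algebra F A]

/-- The lists whose image under `p` is the given list. -/
def listFiber [Fintype V] (p : V → X) : List X → Finset (List V)
  | [] => {[]}
  | v :: w => (({i | p i = v} : Finset V) ×ˢ listFiber p w).image fun q => q.1 :: q.2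

theorem mem_listFiber [Fintype V] (p : V → X) :
    ∀ (w : List X) (l : List V), l ∈ listFiber p w ↔ l.map p = w
  | [], l => by simp [listFiber]
  | v :: w, l => by
    cases l with
    | nil => simp [listFiber]
    | cons i l => simp [listFiber, mem_listFiber p w]

theorem prod_map_sum [Fintype V] (p : V → X) (t : V → A) : ∀ w : List X,
    (w.map fun v => ∑ i with p i = v, t i).prod = ∑ l ∈ listFiber p w, (l.map t).prod
  | [] => by simp [listFiber]
  | v :: w => by
    rw [List.map_cons, List.prod_cons, prod_map_sum p t w, listFiber, Finset.sum_image,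
      Finset.sum_product, Finset.sum_mul_sum]
    · simp
    · rintro ⟨i, l⟩ _ ⟨j, m⟩ _ h
      simpa using h

theorem prod_map_ite_of_mem (s : V → A) {T : Finset V} {l : List V} {i : V} (hi : i ∈ l)
    (hT : i ∉ T) : (l.map fun i => if i ∈ T then s i else 0).prod = 0 := by
  obtain ⟨u, v, rfl⟩ := List.append_of_mem hi
  simp [hT]

/-- If a combination of words vanishes whenever some of the variables are replaced by zero, then
so does its part consisting of the words that contain all variables from `U`. -/
theorem sum_words_containing_eq_zero (L : Finset (List V)) (c : List V → F) (s : V → A)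
    (h : ∀ T : Finset V, ∑ l ∈ L, c l • (l.map fun i => if i ∈ T then s i else 0).prod = 0)
    (U : Finset V) : ∀ T : Finset V,
      ∑ l ∈ L with U ⊆ l.toFinset, c l • (l.map fun i => if i ∈ T then s i else 0).prod = 0 := by
  induction U using Finset.induction_on with
  | empty => simpa using h
  | insert i U _ ih =>
    intro T
    have h1 := ih T
    have h2 := ih (T.erase i)
    rw [← Finset.sum_filter_add_sum_filter_not _ (fun l : List V => i ∈ l)] at h1 h2
    -- Dropping `i` from `T` kills the words containing `i` and leaves the others unchanged; the
    -- others therefore sum to zero, and so do the words containing `i`.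
    rw [Finset.sum_eq_zero, zero_add] at h2
    · have h3 : ∀ l ∈ ({l ∈ ({l ∈ L | U ⊆ l.toFinset} : Finset _) | i ∉ l} : Finset (List V)),
          c l • (l.map fun j => if j ∈ T.erase i then s j else 0).prod =
            c l • (l.map fun j => if j ∈ T then s j else 0).prod := by
        intro l hl
        congr 2
        refine List.map_congr_left fun j hj => ?_
        have : j ≠ i := fun h' => (Finset.mem_filter.1 hl).2 (h' ▸ hj)
        simp [this]
      rw [Finset.sum_congr rfl h3] at h2
      rw [h2, add_zero, Finset.filter_filter] at h1
      refine Eq.trans ?_ h1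
      refine Finset.sum_congr (Finset.filter_congr fun l _ => ?_) fun _ _ => rfl
      rw [Finset.insert_subset_iff, List.mem_toFinset, and_comm]
    · intro l hl
      rw [prod_map_ite_of_mem s (Finset.mem_filter.1 hl).2 (Finset.notMem_erase i T), smul_zero]

end Polarization

/-! ### Permutations as words, and reordering up to sign -/

theorem exists_perm_ofFn {n : ℕ} {l : List (Fin n)} (hl : l.Nodup) (h : ∀ i, i ∈ l) :
    ∃ σ : Equiv.Perm (Fin n), List.ofFn σ = l := by
  have hlen : l.length = n := by
    rw [← List.toFinset_card_of_nodup hl, Finset.eq_univ_of_forall (s := l.toFinset) (by simpa),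
      Finset.card_univ, Fintype.card_fin]
  have hinj : Function.Injective fun i : Fin n => l.get (i.cast hlen.symm) := fun i j hij =>
    Fin.cast_injective _ (List.nodup_iff_injective_get.1 hl hij)
  refine ⟨Equiv.ofBijective _ (Finite.injective_iff_bijective.1 hinj), ?_⟩
  refine List.ext_get (by simp [hlen]) fun i _ _ => ?_
  simp

theorem ofFn_perm_perm {n : ℕ} (σ : Equiv.Perm (Fin n)) : (List.ofFn σ).Perm (List.finRange n) := by
  rw [List.perm_ext_iff_of_nodup (List.nodup_ofFn.2 σ.injective) (List.nodup_finRange n)]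
  intro i
  simpa [List.mem_ofFn] using σ.surjective i

section Signs

variable {F : Type*} [Field F] {V : Type*} {A : Type*} [Ring A] [Algebra F A]

/-- Products of pairwise commuting or anticommuting factors in two different orders agree up to
sign. -/
theorem exists_smul_of_perm {z : V → A}
    (hz : ∀ i j, z i * z j = z j * z i ∨ z i * z j = -(z j * z i))
    {l l' : List V} (h : l.Perm l') : ∃ ε : F, (l.map z).prod = ε • (l'.map z).prod := by
  induction h with
  | nil => exact ⟨1, by simp⟩
  | cons x _ ih =>
    obtain ⟨ε, h⟩ := ih
    exact ⟨ε, by simp [h]⟩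
  | swap x y l =>
    rcases hz y x with h | h
    · exact ⟨1, by simp only [List.map_cons, List.prod_cons, ← mul_assoc, h, one_smul]⟩
    · exact ⟨-1, by simp only [List.map_cons, List.prod_cons, ← mul_assoc, h, neg_smul, one_smul,
        neg_mul]⟩
  | trans _ _ ih ih' =>
    obtain ⟨ε, h⟩ := ih
    obtain ⟨ε', h'⟩ := ih'
    exact ⟨ε * ε', by rw [h, h', smul_smul]⟩

/-- Reordering signs depend only on which pairs anticommute. The nonzero product of the `s i` forces
the signed sum of coefficients to vanish, and that same scalar governs the `t i`. -/
theorem sum_perm_eq_zero_transfer {B : Type*} [Ring B] [Algebra F B] {n : ℕ} {s : Fin n → A}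
    {t : Fin n → B}
    (hst : ∀ i j, (s i * s j = s j * s i ∧ t i * t j = t j * t i) ∨
      (s i * s j = -(s j * s i) ∧ t i * t j = -(t j * t i)))
    (hs : ((List.finRange n).map s).prod ≠ 0) (c : Equiv.Perm (Fin n) → F)
    (h : ∑ σ, c σ • ((List.ofFn σ).map s).prod = 0) :
    ∑ σ, c σ • ((List.ofFn σ).map t).prod = 0 := by
  -- Reordering in the product algebra yields one sign valid for both families.
  have hz : ∀ i j, (s i, t i) * (s j, t j) = (s j, t j) * (s i, t i) ∨
      (s i, t i) * (s j, t j) = -((s j, t j) * (s i, t i)) := fun i j => by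
    rcases hst i j with ⟨h1, h2⟩ | ⟨h1, h2⟩
    · left; simp [h1, h2]
    · right; simp [h1, h2]
  have hε := fun σ : Equiv.Perm (Fin n) =>
    exists_smul_of_perm (F := F) (z := fun i => (s i, t i)) hz (ofFn_perm_perm σ)
  choose ε hε using hε
  have h1 : ∀ σ : Equiv.Perm (Fin n), ((List.ofFn σ).map s).prod =
      ε σ • ((List.finRange n).map s).prod := fun σ => by
    have := congrArg (AlgHom.fst F A B) (hε σ)
    rw [map_smul, map_list_prod, map_list_prod, List.map_map, List.map_map] at this
    exact this
  have h2 : ∀ σ : Equiv.Perm (Fin n), ((List.ofFn σ).map t).prod =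
      ε σ • ((List.finRange n).map t).prod := fun σ => by
    have := congrArg (AlgHom.snd F A B) (hε σ)
    rw [map_smul, map_list_prod, map_list_prod, List.map_map, List.map_map] at this
    exact this
  simp only [h1, smul_smul, ← Finset.sum_smul] at h
  rw [smul_eq_zero_iff_left hs] at h
  simp only [h2, smul_smul, ← Finset.sum_smul, h, zero_smul]

end Signs

/-! ### Substituting exterior monomials for variables -/

section MonomialSubstitution

variable {F : Type*} [Field F] {V : Type*}

theorem prod_map_extMon {W : Type*} (l : W → List V) (L : List W) :
    (L.map fun i => extMon F (l i)).prod = extMon F (L.map l).flatten := by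
  induction L with
  | nil => rfl
  | cons i L ih => simp [extMon_append, ih]

theorem prod_map_extMon_eq_zero {W : Type*} {l : W → List V} (hl : ∀ i, l i ≠ []) {L : List W}
    (hL : ¬ L.Nodup) : (L.map fun i => extMon F (l i)).prod = 0 := by
  rw [prod_map_extMon]
  refine extMon_eq_zero fun h => hL ?_
  rw [List.nodup_flatten] at h
  refine (List.pairwise_map.1 h.2).imp fun {i j} hij hij' => ?_
  subst hij'
  obtain ⟨v, hv⟩ := List.exists_mem_of_ne_nil _ (hl i)
  exact hij hv hv

/-- The polarization of `f` vanishes on every choice of monomials with the prescribed parities and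
hence on the corresponding exterior algebra generators. -/
theorem sum_perm_paritySubst_eq_zero {X : Type*} [DecidableEq X] {n : ℕ} (p : Fin n → X)
    (c : List X →₀ F) (l : Fin n → List V) (J : Finset (Fin n)) (hl : ∀ i, l i ≠ [])
    (hJ : ∀ i, Odd (l i).length ↔ i ∈ J) (hnd : ((List.finRange n).map l).flatten.Nodup)
    (h : ∀ T : Finset (Fin n), c.sum (fun w r => r • (w.map fun v =>
      ∑ i with p i = v, if i ∈ T then extMon F (l i) else 0).prod) = 0) :
    ∑ σ : Equiv.Perm (Fin n), c (List.ofFn (p ∘ σ)) •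
      ((List.ofFn σ).map (paritySubst F J)).prod = 0 := by
  classical
  set s : Fin n → ExteriorAlgebra F (V →₀ F) := fun i => extMon F (l i) with hs
  set L : Finset (List (Fin n)) := c.support.biUnion (listFiber p) with hL
  have hmem : ∀ m : List (Fin n), c (m.map p) ≠ 0 → m ∈ L := fun m hm =>
    Finset.mem_biUnion.2 ⟨_, Finsupp.mem_support_iff.2 hm, (mem_listFiber p _ _).2 rfl⟩
  have h1 : ∀ T : Finset (Fin n),
      ∑ m ∈ L, c (m.map p) • (m.map fun i => if i ∈ T then s i else 0).prod = 0 := by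
    intro T
    refine Eq.trans ?_ (h T)
    rw [hL, Finset.sum_biUnion, Finsupp.sum]
    · refine Finset.sum_congr rfl fun w _ => ?_
      rw [prod_map_sum, Finset.smul_sum]
      refine Finset.sum_congr rfl fun m hm => ?_
      rw [(mem_listFiber p w m).1 hm]
    · intro w _ w' _ hww'
      refine Finset.disjoint_left.2 fun m hm hm' => hww' ?_
      rw [← (mem_listFiber p w m).1 hm, (mem_listFiber p w' m).1 hm']
  have h2 := sum_words_containing_eq_zero L (fun m => c (m.map p)) s h1 Finset.univ Finset.univ
  simp only [Finset.mem_univ, if_true] at h2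
  refine sum_perm_eq_zero_transfer (s := s) (fun i j => ?_) ?_ _ ?_
  · by_cases hi : i ∈ J
    · by_cases hj : j ∈ J
      · right
        refine ⟨?_, by simp only [paritySubst, if_pos hi, if_pos hj]; exact extGen_mul_extGen i j⟩
        rw [hs]
        simp only
        rw [extMon_mul_extMon, (((hJ i).2 hi).mul ((hJ j).2 hj)).neg_one_pow, neg_one_smul]
      · left
        refine ⟨?_, by simp [paritySubst, hj]⟩
        have : Even (l j).length := by rwa [← Nat.not_odd_iff_even, hJ]
        rw [hs]
        simp only
        rw [extMon_mul_extMon, (this.mul_left _).neg_one_pow, one_smul]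
    · left
      refine ⟨?_, by simp [paritySubst, hi]⟩
      have : Even (l i).length := by rwa [← Nat.not_odd_iff_even, hJ]
      rw [hs]
      simp only
      rw [extMon_mul_extMon, (this.mul_right _).neg_one_pow, one_smul]
  · rw [prod_map_extMon]
    exact extMon_ne_zero hnd
  · rw [← h2]
    refine Finset.sum_bij_ne_zero (fun σ _ _ => List.ofFn σ) ?_ ?_ ?_ ?_
    · intro σ _ hσ
      refine Finset.mem_filter.2 ⟨hmem _ ?_, fun i _ => ?_⟩
      · rw [List.map_ofFn]
        exact fun h0 => hσ (by rw [h0, zero_smul])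
      · simpa [List.mem_ofFn] using σ.surjective i
    · intro σ _ _ τ _ _ hστ
      exact DFunLike.coe_injective (List.ofFn_injective hστ)
    · intro m hm hm0
      have hfull : ∀ i, i ∈ m := fun i => by
        simpa using (Finset.mem_filter.1 hm).2 (Finset.mem_univ i)
      -- A repeated index would repeat a nonempty monomial and kill the product, so the surviving
      -- words are exactly the permutations.
      have hnd' : m.Nodup := by
        by_contra hcon
        exact hm0 (by rw [hs, prod_map_extMon_eq_zero hl hcon, smul_zero])
      obtain ⟨σ, rfl⟩ := exists_perm_ofFn hnd' hfull
      exact ⟨σ, Finset.mem_univ _, by rwa [List.map_ofFn] at hm0, rfl⟩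
    · intro σ _ _
      rw [List.map_ofFn (g := p)]

/-- A polynomial whose polarization at `p` vanishes under monomial substitutions of all parities
has zero polarization in every algebra with central commutators. -/
theorem sum_perm_prod_eq_zero [CharZero F] {Q : Type*} [Ring Q] [Algebra F Q]
    (hQ : CentralCommutators Q) {n : ℕ} (c : Equiv.Perm (Fin n) → F) (x : Fin n → Q)
    (h : ∀ J : Finset (Fin n), ∑ σ, c σ • ((List.ofFn σ).map (paritySubst F J)).prod = 0) :
    ∑ σ, c σ • ((List.ofFn σ).map x).prod = 0 := by
  -- `Q` itself need not map to exterior algebras. Adjoining one exterior factor per parity pattern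
  -- makes the projections serve as the required homomorphisms and keeps commutators central.
  let R := Q × (Finset (Fin n) → ExteriorAlgebra F (Fin n →₀ F))
  let y : Fin n → R := fun i => (x i, fun J => paritySubst F J i)
  let τ : Finset (Fin n) → R →ₐ[F] ExteriorAlgebra F (Fin n →₀ F) := fun J =>
    (Pi.evalAlgHom F _ J).comp (AlgHom.snd F _ _)
  have hτ : ∀ J v, τ J (y v) = paritySubst F J v := fun _ _ => rfl
  have hR : CentralCommutators R := hQ.prod (.pi fun _ => centralCommutators_exterior F (Fin n))
  have h0 : ∑ σ, c σ • ((List.ofFn σ).map y).prod = 0 := by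
    refine eq_zero_of_paritySubst (F := F) hR y τ hτ _ Finset.univ rfl _ ?_ fun J _ => ?_
    · refine sum_mem fun σ _ => Submodule.smul_mem _ _ (Submodule.subset_span
        ⟨_, List.nodup_ofFn.2 σ.injective, ?_, rfl⟩)
      refine Finset.eq_univ_of_forall fun i => ?_
      simpa [List.mem_ofFn] using σ.surjective i
    · rw [map_sum, ← h J]
      refine Finset.sum_congr rfl fun σ _ => ?_
      rw [map_smul, map_prod_paritySubst (hτ J)]
  have := congrArg (AlgHom.fst F Q _) h0
  rw [map_sum, map_zero] at this
  rw [← this]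
  refine Finset.sum_congr rfl fun σ _ => ?_
  rw [map_smul, map_list_prod, List.map_map]
  rfl

end MonomialSubstitution


/-! ### Gradings spanned by monomials -/

section Components

variable {ι : Type*} {F : Type*} [Field F] {A : Type*} [Ring A] [Algebra F A] {v : ι → A}
  {deg : ι → ℤ}

theorem prod_mem_monomialComponent (l : List ι) :
    (l.map v).prod ∈ monomialComponent F v deg (l.map deg).sum :=
  Submodule.subset_span ⟨l, rfl, rfl⟩

theorem mul_mem_monomialComponent {g h : ℤ} {x y : A} (hx : x ∈ monomialComponent F v deg g)
    (hy : y ∈ monomialComponent F v deg h) : x * y ∈ monomialComponent F v deg (g + h) := by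
  have := Submodule.mul_mem_mul hx hy
  rw [monomialComponent, monomialComponent, Submodule.span_mul_span] at this
  refine Submodule.span_mono ?_ this
  rintro _ ⟨_, ⟨l, rfl, rfl⟩, _, ⟨l', rfl, rfl⟩, rfl⟩
  exact ⟨l ++ l', by simp, by simp⟩

theorem list_prod_mem_monomialComponent {W : Type*} {s : W → A} {e : W → ℤ}
    (hs : ∀ w, s w ∈ monomialComponent F v deg (e w)) :
    ∀ L : List W, (L.map s).prod ∈ monomialComponent F v deg (L.map e).sum
  | [] => prod_mem_monomialComponent []
  | w :: L => by
    simpa using mul_mem_monomialComponent (hs w) (list_prod_mem_monomialComponent hs L)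

theorem lift_mem_monomialComponent {s : ℤ × ℕ → A}
    (hs : ∀ p, s p ∈ monomialComponent F v deg p.1) {g : ℤ} {f : FreeGraded F}
    (hf : f ∈ freeComponent F g) : FreeAlgebra.lift F s f ∈ monomialComponent F v deg g := by
  induction hf using Submodule.span_induction with
  | mem m hm =>
    obtain ⟨l, rfl, rfl⟩ := hm
    rw [map_list_prod, List.map_map]
    refine list_prod_mem_monomialComponent (fun p => ?_) l
    simpa [var] using hs p
  | zero => simp
  | add a b _ _ ha hb => rw [map_add]; exact add_mem ha hb
  | smul c a _ ha => rw [map_smul]; exact Submodule.smul_mem _ _ ha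

theorem var_mem_freeComponent (p : ℤ × ℕ) : var F p ∈ freeComponent F p.1 := by
  simpa using! prod_mem_monomialComponent (F := F) (v := var F) (deg := Prod.fst) [p]

theorem mem_gradedIdentities {𝒜 : ℤ → Submodule F A} {f : FreeGraded F} :
    f ∈ gradedIdentities 𝒜 ↔ IsGradedIdentity 𝒜 f :=
  TwoSidedIdeal.mem_mk' _ _ _ _ _ _ _

theorem isTIdeal_gradedIdentities : IsTIdeal (gradedIdentities (monomialComponent F v deg)) := by
  intro φ hφ f hf
  rw [mem_gradedIdentities] at hf ⊢
  intro s hs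
  have h1 : (FreeAlgebra.lift F s).comp φ =
      FreeAlgebra.lift F fun p => FreeAlgebra.lift F s (φ (var F p)) := by
    ext p
    simp [var]
  rw [← AlgHom.comp_apply, h1]
  exact hf _ fun p => lift_mem_monomialComponent hs (hφ _ _ (var_mem_freeComponent p))

/-- A graded substitution in the free graded algebra preserves `T`-ideals. -/
theorem IsTIdeal.lift_mem {I : TwoSidedIdeal (FreeGraded F)} (hI : IsTIdeal I)
    {s : ℤ × ℕ → FreeGraded F} (hs : ∀ p, s p ∈ freeComponent F p.1) {f : FreeGraded F}
    (hf : f ∈ I) : FreeAlgebra.lift F s f ∈ I :=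
  hI _ (fun _ _ hf => lift_mem_monomialComponent hs hf) f hf

theorem span_words (F : Type*) [Field F] (X : Type*) :
    Submodule.span F (Set.range fun l : List X => (l.map (FreeAlgebra.ι F)).prod) = ⊤ := by
  rw [eq_top_iff]
  rintro q -
  induction q using FreeAlgebra.induction with
  | grade0 r =>
    rw [Algebra.algebraMap_eq_smul_one]
    exact Submodule.smul_mem _ _ (Submodule.subset_span ⟨[], by simp⟩)
  | grade1 x => exact Submodule.subset_span ⟨[x], by simp⟩
  | mul a b ha hb =>
    have := Submodule.mul_mem_mul ha hb
    rw [Submodule.span_mul_span] at this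
    refine Submodule.span_mono ?_ this
    rintro _ ⟨_, ⟨l, rfl⟩, _, ⟨l', rfl⟩, rfl⟩
    exact ⟨l ++ l', by simp⟩
  | add a b ha hb => exact add_mem ha hb

theorem exists_sum_words {X : Type*} (f : FreeAlgebra F X) :
    ∃ c : List X →₀ F, f = c.sum fun l r => r • (l.map (FreeAlgebra.ι F)).prod := by
  have : f ∈ Submodule.span F (Set.range fun l : List X => (l.map (FreeAlgebra.ι F)).prod) :=
    span_words F X ▸ Submodule.mem_top
  obtain ⟨c, hc⟩ := Finsupp.mem_span_range_iff_exists_finsupp.1 this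
  exact ⟨c, hc.symm⟩

theorem mkₐ_eq_zero_iff {R : Type*} [Ring R] [Algebra F R] (I : TwoSidedIdeal R) (f : R) :
    I.ringCon.mkₐ F f = 0 ↔ f ∈ I := by
  rw [← map_zero (I.ringCon.mkₐ F), TwoSidedIdeal.mem_iff]
  exact RingCon.eq _

/-- Monomials are homogeneous and span, so a triple commutator of monomials is a graded substitution
instance of one in variables. -/
theorem centralCommutators_quotient {I : TwoSidedIdeal (FreeGraded F)} (hI : IsTIdeal I)
    (h : tripleCommutators F ⊆ {f | f ∈ I}) : CentralCommutators I.ringCon.Quotient := by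
  refine .of_span (F := F) (s := (I.ringCon.mkₐ F) '' Set.range
    fun l : List (ℤ × ℕ) => (l.map (FreeAlgebra.ι F)).prod) ?_ ?_
  · have := Submodule.map_span (I.ringCon.mkₐ F).toLinearMap
      (Set.range fun l : List (ℤ × ℕ) => (l.map (FreeAlgebra.ι F)).prod)
    rw [span_words, Submodule.map_top] at this
    exact this.symm.trans (LinearMap.range_eq_top.2 (RingCon.mkₐ_surjective (α := F) I.ringCon))
  · rintro _ ⟨_, ⟨l₀, rfl⟩, rfl⟩ _ ⟨_, ⟨l₁, rfl⟩, rfl⟩ _ ⟨_, ⟨l₂, rfl⟩, rfl⟩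
    let l : Fin 3 → List (ℤ × ℕ) := ![l₀, l₁, l₂]
    -- The second index keeps the variables distinct even when degrees coincide.
    let x : Fin 3 → ℤ × ℕ := fun i => (((l i).map Prod.fst).sum, i)
    have hx : Function.Injective x := fun i j hij => Fin.ext (Prod.ext_iff.1 hij).2
    classical
    let s : ℤ × ℕ → FreeGraded F := fun p =>
      if h : ∃ i, x i = p then ((l h.choose).map (var F)).prod else var F p
    have hsx : ∀ i, s (x i) = ((l i).map (var F)).prod := fun i => by
      have hex : ∃ j, x j = x i := ⟨i, rfl⟩
      have : hex.choose = i := hx hex.choose_spec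
      simp only [s, dif_pos hex, this]
    have hs : ∀ p, s p ∈ freeComponent F p.1 := fun p => by
      by_cases hex : ∃ i, x i = p
      · obtain ⟨i, rfl⟩ := hex
        rw [hsx]
        exact prod_mem_monomialComponent (l i)
      · simp only [s, dif_neg hex]
        exact var_mem_freeComponent p
    have h1 := (mkₐ_eq_zero_iff (F := F) I _).2 (hI.lift_mem hs (h ⟨x, hx, rfl⟩))
    simp only [Ring.lie_def, map_sub, map_mul, var, FreeAlgebra.lift_ι_apply, hsx] at h1 ⊢
    exact h1

end Components

/-! ### Residues of degrees -/

/-- The residue `r` modulo `d` with `g ≡ r c` modulo `d`. -/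
def degResidue (d : ℕ) (c g : ℤ) : ℕ := ((g * Int.gcdA c d) % d).toNat

section Residue

variable {d : ℕ} {c : ℤ}

theorem degResidue_cast (hd : 0 < d) (g : ℤ) :
    (degResidue d c g : ℤ) = (g * Int.gcdA c d) % d :=
  Int.toNat_of_nonneg (Int.emod_nonneg _ (by positivity))

theorem degResidue_lt (hd : 0 < d) (g : ℤ) : degResidue d c g < d := by
  have := Int.emod_lt_of_pos (g * Int.gcdA c d) (b := d) (by positivity)
  rw [← degResidue_cast hd] at this
  exact_mod_cast this

theorem dvd_sub_degResidue (hd : 0 < d) (hcd : Int.gcd c d = 1) (g : ℤ) :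
    (d : ℤ) ∣ g - degResidue d c g * c := by
  have h1 := Int.gcd_eq_gcd_ab c d
  rw [hcd] at h1
  rw [degResidue_cast hd]
  have h2 := Int.emod_add_mul_ediv (g * Int.gcdA c d) d
  refine ⟨g * Int.gcdB c d + c * (g * Int.gcdA c d / d), ?_⟩
  push_cast at h1
  linear_combination g * h1 - c * h2

/-- The residue is unique because `c` is invertible modulo `d`. -/
theorem degResidue_eq_mod (hd : 0 < d) (hcd : Int.gcd c d = 1) {g : ℤ} {z : ℕ}
    (h : (d : ℤ) ∣ g - z * c) : degResidue d c g = z % d := by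
  have h1 := dvd_sub h (dvd_sub_degResidue hd hcd g)
  have h2 : g - z * c - (g - degResidue d c g * c) = c * (degResidue d c g - z) := by ring
  rw [h2] at h1
  have h3 : (d : ℤ) ∣ degResidue d c g - z :=
    Int.dvd_of_dvd_mul_right_of_gcd_one h1 (by rw [Int.gcd_comm]; exact hcd)
  have h4 : z ≡ degResidue d c g [MOD d] := (Nat.modEq_iff_dvd).2 h3
  rw [← Nat.mod_eq_of_lt (degResidue_lt (c := c) hd g)]
  exact h4.symm

theorem degResidue_add_of_dvd (hd : 0 < d) (hcd : Int.gcd c d = 1) (g : ℤ) {h : ℤ}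
    (hh : (d : ℤ) ∣ h) : degResidue d c (g + h) = degResidue d c g := by
  rw [degResidue_eq_mod hd hcd (g := g + h) (z := degResidue d c g),
    Nat.mod_eq_of_lt (degResidue_lt hd g)]
  have := dvd_add (dvd_sub_degResidue hd hcd g) hh
  rwa [sub_add_eq_add_sub] at this

theorem degResidue_eq_zero_iff (hd : 0 < d) (hcd : Int.gcd c d = 1) (g : ℤ) :
    degResidue d c g = 0 ↔ (d : ℤ) ∣ g := by
  constructor
  · intro h
    simpa [h] using dvd_sub_degResidue hd hcd g
  · intro h
    rw [degResidue_eq_mod hd hcd (z := 0) (by simpa using h), Nat.zero_mod]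

end Residue

/-! ### Long words lie in the ideal -/

section LongWords

variable {F : Type*} [Field F] {d k : ℕ} {c : ℤ}

/-- A word decomposes as a prefix of degree divisible by `d` followed by blocks of nonzero
residue. -/
theorem exists_blocks (F : Type*) [Field F] (hd : 0 < d) (hcd : Int.gcd c d = 1) :
    ∀ l : List (ℤ × ℕ), ∃ (g₀ : ℤ) (m₀ : FreeGraded F) (B : List (ℤ × FreeGraded F)),
      (d : ℤ) ∣ g₀ ∧ m₀ ∈ freeComponent F g₀ ∧
      (∀ q ∈ B, q.2 ∈ freeComponent F q.1 ∧ degResidue d c q.1 ≠ 0) ∧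
      (B.map fun q => degResidue d c q.1).sum = (l.map fun p => degResidue d c p.1).sum ∧
      (l.map (var F)).prod = m₀ * (B.map Prod.snd).prod
  | [] => ⟨0, 1, [], dvd_zero _, prod_mem_monomialComponent [], by simp, by simp, by simp⟩
  | p :: l => by
    obtain ⟨g₀, m₀, B, hg, hm, hB, hsum, hprod⟩ := exists_blocks F hd hcd l
    have hm' := mul_mem_monomialComponent (var_mem_freeComponent (F := F) p) hm
    by_cases hp : degResidue d c p.1 = 0
    · refine ⟨p.1 + g₀, var F p * m₀, B, ?_, hm', hB, by simp [hsum, hp], ?_⟩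
      · exact dvd_add ((degResidue_eq_zero_iff hd hcd _).1 hp) hg
      · rw [List.map_cons, List.prod_cons, hprod, mul_assoc]
    -- A letter of nonzero residue absorbs the pending prefix into a new block, without changing its
    -- own residue because `d ∣ g₀`.
    · refine ⟨0, 1, (p.1 + g₀, var F p * m₀) :: B, dvd_zero _, prod_mem_monomialComponent [],
        ?_, ?_, ?_⟩
      · intro q hq
        rcases List.mem_cons.1 hq with rfl | hq
        · exact ⟨hm', by rwa [degResidue_add_of_dvd hd hcd _ hg]⟩
        · exact hB q hq
      · simp [hsum, degResidue_add_of_dvd hd hcd _ hg]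
      · simp [hprod, mul_assoc]

theorem word_mem_of_lt_sum {I : TwoSidedIdeal (FreeGraded F)} (hI : IsTIdeal I) (hd : 0 < d)
    (hcd : Int.gcd c d = 1) (h : longProducts F d c k ⊆ {f | f ∈ I}) (l : List (ℤ × ℕ))
    (hl : k < (l.map fun p => degResidue d c p.1).sum) : (l.map (var F)).prod ∈ I := by
  obtain ⟨g₀, m₀, B, -, -, hB, hsum, hprod⟩ := exists_blocks F hd hcd l
  rw [hprod]
  refine I.mul_mem_left _ _ ?_
  let u : Fin B.length → ℤ × ℕ := fun i => ((B.get i).1, i)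
  have hu : Function.Injective u := fun i j hij => Fin.ext (Prod.ext_iff.1 hij).2
  classical
  let s : ℤ × ℕ → FreeGraded F := fun p =>
    if h : ∃ i, u i = p then (B.get h.choose).2 else var F p
  have hsu : ∀ i, s (u i) = (B.get i).2 := fun i => by
    have hex : ∃ j, u j = u i := ⟨i, rfl⟩
    have : hex.choose = i := hu hex.choose_spec
    simp only [s, dif_pos hex, this]
  have hs : ∀ p, s p ∈ freeComponent F p.1 := fun p => by
    by_cases hex : ∃ i, u i = p
    · obtain ⟨i, rfl⟩ := hex
      rw [hsu]
      exact (hB _ (List.get_mem B i)).1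
    · simp only [s, dif_neg hex]
      exact var_mem_freeComponent p
  choose q hq using fun i => dvd_sub_degResidue hd hcd (u i).1
  have hmem : (List.ofFn fun i => var F (u i)).prod ∈ I := by
    refine h ⟨B.length, u, q, fun i => degResidue d c (u i).1, hu, fun i => ?_, ?_, rfl⟩
    · have h0 := (hB _ (List.get_mem B i)).2
      refine ⟨fun hdvd => h0 ((degResidue_eq_zero_iff hd hcd _).2 hdvd), ?_,
        Nat.one_le_iff_ne_zero.2 h0, Nat.le_sub_one_of_lt (degResidue_lt hd _)⟩
      have := hq i
      linarith
    · rw [← hsum] at hl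
      rwa [← List.sum_ofFn, show (List.ofFn fun i => degResidue d c (u i).1) =
        B.map fun q => degResidue d c q.1 from ?_]
      refine List.ext_get (by simp) fun i _ _ => ?_
      simp [u]
  have h2 := hI.lift_mem hs hmem
  rw [map_list_prod, List.map_ofFn] at h2
  rwa [show (List.ofFn (FreeAlgebra.lift F s ∘ fun i => var F (u i))) = B.map Prod.snd from ?_]
    at h2
  refine List.ext_get (by simp) fun i _ _ => ?_
  simp only [List.get_ofFn, Function.comp_apply, var, FreeAlgebra.lift_ι_apply, hsu]
  simp

end LongWords


/-! ### The grading of the Grassmann algebra -/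

section Grading

variable {F : Type*} [Field F] {a b c : ℤ} {d k : ℕ} {δ : ℕ → ℤ}

/-- The span of the monomials containing at least `r` generators of degree `c`. -/
noncomputable def manyGenerators (F : Type*) [Field F] (δ : ℕ → ℤ) (c : ℤ) (r : ℕ) :
    Submodule F (Grassmann F) :=
  Submodule.span F {m | ∃ l : List ℕ, r ≤ l.countP (fun i => δ i = c) ∧ m = extMon F l}

theorem list_prod_mem_manyGenerators {W : Type*} {s : W → Grassmann F} {ρ : W → ℕ}
    (hs : ∀ w, s w ∈ manyGenerators F δ c (ρ w)) :
    ∀ L : List W, (L.map s).prod ∈ manyGenerators F δ c (L.map ρ).sum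
  | [] => Submodule.subset_span ⟨[], by simp, by simp [extMon_nil]⟩
  | w :: L => by
    have := Submodule.mul_mem_mul (hs w) (list_prod_mem_manyGenerators hs L)
    rw [manyGenerators, manyGenerators, Submodule.span_mul_span] at this
    rw [List.map_cons (f := s), List.prod_cons]
    refine Submodule.span_mono ?_ this
    rintro _ ⟨_, ⟨l, hl, rfl⟩, _, ⟨l', hl', rfl⟩, rfl⟩
    refine ⟨l ++ l', ?_, (extMon_append l l').symm⟩
    rw [List.countP_append, List.map_cons, List.sum_cons]
    exact add_le_add hl hl'

/-- With only `k` generators of degree `c` available, some generator must repeat. -/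
theorem eq_zero_of_mem_manyGenerators (hk : {i : ℕ | δ i = c}.encard = k) {r : ℕ} (hr : k < r)
    {q : Grassmann F} (hq : q ∈ manyGenerators F δ c r) : q = 0 := by
  induction hq using Submodule.span_induction with
  | mem m hm =>
    obtain ⟨l, hl, rfl⟩ := hm
    refine extMon_eq_zero fun hnd => ?_
    have h1 : ((l.filter fun i => δ i = c).toFinset : Set ℕ) ⊆ {i | δ i = c} := fun i hi => by
      simpa using (List.mem_filter.1 (List.mem_toFinset.1 hi)).2
    have h2 := Set.encard_le_encard h1
    rw [hk, Set.encard_coe_eq_coe_finsetCard, List.toFinset_card_of_nodup (hnd.filter _),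
      ← List.countP_eq_length_filter] at h2
    have : l.countP (fun i => δ i = c) ≤ k := by exact_mod_cast h2
    omega
  | zero => rfl
  | add x y _ _ hx hy => rw [hx, hy, add_zero]
  | smul r x _ hx => rw [hx, smul_zero]

theorem dvd_sum_sub_countP (hδ : ∀ i, δ i = c ∨ (d : ℤ) ∣ δ i) : ∀ l : List ℕ,
    (d : ℤ) ∣ (l.map δ).sum - (l.countP fun i => δ i = c : ℕ) * c
  | [] => by simp
  | i :: l => by
    have ih := dvd_sum_sub_countP hδ l
    rw [List.map_cons, List.sum_cons, List.countP_cons]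
    by_cases h : δ i = c
    · simp only [h, decide_true, if_true]
      convert ih using 1
      push_cast
      ring
    · have h' := (hδ i).resolve_left h
      simp only [h, decide_false, Bool.false_eq_true, if_false, add_zero]
      rw [add_sub_assoc]
      exact dvd_add h' ih

/-- The number of generators of degree `c` is congruent to the residue modulo `d`, hence at least
the residue. -/
theorem grassmannComponent_le_manyGenerators (hd : 0 < d) (hcd : Int.gcd c d = 1)
    (hδ : ∀ i, δ i = c ∨ (d : ℤ) ∣ δ i) (g : ℤ) :
    grassmannComponent F δ g ≤ manyGenerators F δ c (degResidue d c g) := by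
  refine Submodule.span_mono ?_
  rintro _ ⟨l, rfl, rfl⟩
  refine ⟨l, ?_, rfl⟩
  rw [degResidue_eq_mod hd hcd (dvd_sum_sub_countP hδ l)]
  exact Nat.mod_le _ _

theorem tripleCommutators_subset_gradedIdentities (F : Type*) [Field F] (δ : ℕ → ℤ) :
    tripleCommutators F ⊆ {f | f ∈ gradedIdentities (grassmannComponent F δ)} := by
  rintro _ ⟨x, -, rfl⟩
  rw [Set.mem_ofPred_eq, mem_gradedIdentities]
  intro s _
  have := centralCommutators_exterior F ℕ (s (x 0)) (s (x 1)) (s (x 2))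
  simpa only [Ring.lie_def, map_sub, map_mul, var, FreeAlgebra.lift_ι_apply] using this

theorem longProducts_subset_gradedIdentities (hd : 0 < d) (hcd : Int.gcd c d = 1)
    (hδ : ∀ i, δ i = c ∨ (d : ℤ) ∣ δ i) (hk : {i : ℕ | δ i = c}.encard = k) :
    longProducts F d c k ⊆ {f | f ∈ gradedIdentities (grassmannComponent F δ)} := by
  rintro _ ⟨n, u, q, r, -, hu, hr, rfl⟩
  rw [Set.mem_ofPred_eq, mem_gradedIdentities]
  intro s hs
  have hres : ∀ i, degResidue d c (u i).1 = r i := fun i => by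
    obtain ⟨-, h1, -, h2⟩ := hu i
    rw [degResidue_eq_mod hd hcd (z := r i) ⟨q i, by rw [h1]; ring⟩, Nat.mod_eq_of_lt (by omega)]
  have h1 : ∀ i, s (u i) ∈ manyGenerators F δ c (r i) := fun i =>
    hres i ▸ grassmannComponent_le_manyGenerators hd hcd hδ _ (hs (u i))
  have h2 := list_prod_mem_manyGenerators h1 (List.finRange n)
  rw [← List.ofFn_eq_map, ← List.ofFn_eq_map, List.sum_ofFn] at h2
  rw [map_list_prod, List.map_ofFn]
  simp only [Function.comp_def, var, FreeAlgebra.lift_ι_apply]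
  exact eq_zero_of_mem_manyGenerators hk hr h2

/-! ### Monomials of prescribed degree and parity -/

/-- `a / d` and `b / d` are coprime with even product, so their sum is odd. Shifting a Bézout
solution by `(b / d, a / d)` then flips the parity of `x + y`. The arbitrary `P` selects the parity,
and `1 ≤ x` keeps the resulting monomials nonempty. -/
theorem exists_nat_combination (ha : 0 < a) (hb : 0 < b) (hd : d = Int.gcd a b)
    (heven : Even ((a / d) * (b / d))) {m : ℤ} (hm : (d : ℤ) ∣ m) (P : Prop) :
    ∃ x y : ℕ, 1 ≤ x ∧ a * x - b * y = m ∧ (Odd (x + y) ↔ P) := by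
  have hd0 : 0 < d := hd ▸ Int.gcd_pos_of_ne_zero_left _ ha.ne'
  have hd0' : (0 : ℤ) < d := by exact_mod_cast hd0
  have hcop : Int.gcd (a / d) (b / d) = 1 := by
    rw [hd]; exact Int.gcd_div_gcd_div_gcd (hd ▸ hd0)
  obtain ⟨a', rfl⟩ : (d : ℤ) ∣ a := hd ▸ Int.gcd_dvd_left _ _
  obtain ⟨b', rfl⟩ : (d : ℤ) ∣ b := hd ▸ Int.gcd_dvd_right _ _
  obtain ⟨m', rfl⟩ := hm
  rw [Int.mul_ediv_cancel_left _ hd0'.ne', Int.mul_ediv_cancel_left _ hd0'.ne'] at heven hcop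
  have ha' : 0 < a' := pos_of_mul_pos_right ha hd0'.le
  have hb' : 0 < b' := pos_of_mul_pos_right hb hd0'.le
  have hodd : Odd (a' + b') := by
    rw [← Int.not_even_iff_odd, Int.even_add]
    intro h
    have h2 : Even a' ∧ Even b' := by
      rcases Int.even_mul.1 heven with h' | h'
      · exact ⟨h', h.1 h'⟩
      · exact ⟨h.2 h', h'⟩
    have h3 := Int.dvd_coe_gcd h2.1.two_dvd h2.2.two_dvd
    rw [hcop] at h3
    norm_num at h3
  obtain ⟨u, v, huv⟩ := Int.isCoprime_iff_gcd_eq_one.2 hcop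
  set X := m' * u with hX
  set Y := -(m' * v) with hY
  -- The bound on `t` makes the shifted solution satisfy the sign conditions; one of two consecutive
  -- values of `t` has the wanted parity.
  have key : ∀ t : ℤ, |X| + |Y| + 1 ≤ t → (Odd (X + Y + t * (a' + b')) ↔ P) →
      ∃ x y : ℕ, 1 ≤ x ∧ d * a' * x - d * b' * y = d * m' ∧ (Odd (x + y) ↔ P) := by
    intro t ht hP
    have hX0 := neg_abs_le X
    have hY0 := neg_abs_le Y
    have hX1 := abs_nonneg X
    have hY1 := abs_nonneg Y
    have h1 : 1 ≤ X + t * b' := by nlinarith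
    have h2 : 0 ≤ Y + t * a' := by nlinarith
    have hx : ((X + t * b').toNat : ℤ) = X + t * b' := Int.toNat_of_nonneg (by linarith)
    have hy : ((Y + t * a').toNat : ℤ) = Y + t * a' := Int.toNat_of_nonneg h2
    refine ⟨(X + t * b').toNat, (Y + t * a').toNat, by omega, ?_, ?_⟩
    · rw [hx, hy, hX, hY]
      linear_combination (d * m' : ℤ) * huv
    · rw [← hP, ← Int.odd_coe_nat]
      push_cast
      rw [hx, hy, show X + t * b' + (Y + t * a') = X + Y + t * (a' + b') by ring]
  by_cases hP : Odd (X + Y + (|X| + |Y| + 1) * (a' + b')) ↔ P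
  · exact key _ le_rfl hP
  · refine key (|X| + |Y| + 1 + 1) (by linarith) ?_
    have h1 : X + Y + (|X| + |Y| + 1 + 1) * (a' + b') =
        X + Y + (|X| + |Y| + 1) * (a' + b') + (a' + b') := by ring
    have h2 : Odd (X + Y + (|X| + |Y| + 1 + 1) * (a' + b')) ↔
        ¬ Odd (X + Y + (|X| + |Y| + 1) * (a' + b')) := by
      rw [h1, Int.odd_add, Int.not_odd_iff_even, ← Int.not_odd_iff_even (n := a' + b')]
      simp [hodd]
    rw [h2]
    tauto

theorem nonempty_embedding_of_encard_eq_top {β : Type*} [Fintype β] {s : Set ℕ}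
    (hs : s.encard = ⊤) : Nonempty (β ↪ s) := by
  have : Infinite s := (Set.encard_eq_top_iff.1 hs).to_subtype
  exact ⟨((Fintype.equivFin β).toEmbedding.trans Fin.valEmbedding).trans (Infinite.natEmbedding s)⟩

theorem nonempty_embedding_of_encard_eq {β : Type*} [Fintype β] {s : Set ℕ}
    (hs : s.encard = k) (hβ : Fintype.card β ≤ k) : Nonempty (β ↪ s) := by
  have hfin : s.Finite := Set.finite_of_encard_eq_coe hs
  have := hfin.fintype
  refine Function.Embedding.nonempty_of_card_le ?_
  rw [Set.encard_eq_coe_toFinset_card, Set.toFinset_card] at hs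
  exact hβ.trans (by exact_mod_cast hs.ge)

theorem exists_monomials (ha : 0 < a) (hb : 0 < b) (hbc : -b < c) (hca : c < a)
    (hd : d = Int.gcd a b) (hcd : Int.gcd c d = 1) (heven : Even ((a / d) * (b / d)))
    (hδa : {i : ℕ | δ i = a}.encard = ⊤) (hδb : {i : ℕ | δ i = -b}.encard = ⊤)
    (hδc : {i : ℕ | δ i = c}.encard = k) {n : ℕ} (g : Fin n → ℤ) (J : Finset (Fin n))
    (hg : ∑ i, degResidue d c (g i) ≤ k) :
    ∃ l : Fin n → List ℕ, (∀ i, ((l i).map δ).sum = g i) ∧ (∀ i, l i ≠ []) ∧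
      (∀ i, Odd (l i).length ↔ i ∈ J) ∧ ((List.finRange n).map l).flatten.Nodup := by
  have hd0 : 0 < d := hd ▸ Int.gcd_pos_of_ne_zero_left _ ha.ne'
  set r : Fin n → ℕ := fun i => degResidue d c (g i) with hr
  -- The `r i` generators of degree `c` account for the residue; those of degrees `a` and `-b`
  -- supply the rest of the degree. The chosen condition makes `x + y + r` odd exactly on `J`.
  have hxy := fun i => exists_nat_combination ha hb hd heven
    (dvd_sub_degResidue hd0 hcd (g i)) (i ∈ J ↔ Even (r i))
  choose x y hx hxy hpar using hxy
  obtain ⟨φa⟩ := nonempty_embedding_of_encard_eq_top (β := Σ i, Fin (x i)) hδa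
  obtain ⟨φb⟩ := nonempty_embedding_of_encard_eq_top (β := Σ i, Fin (y i)) hδb
  obtain ⟨φc⟩ := nonempty_embedding_of_encard_eq (β := Σ i, Fin (r i)) hδc (by simpa using hg)
  let K : Fin n → Type := fun i => Fin (x i) ⊕ (Fin (y i) ⊕ Fin (r i))
  let Φ : ∀ i, K i → ℕ := fun i => Sum.elim (fun u => φa ⟨i, u⟩)
    (Sum.elim (fun u => φb ⟨i, u⟩) fun u => φc ⟨i, u⟩)
  have hδφa : ∀ u, δ (φa u) = a := fun u => (φa u).2
  have hδφb : ∀ u, δ (φb u) = -b := fun u => (φb u).2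
  have hδφc : ∀ u, δ (φc u) = c := fun u => (φc u).2
  -- Supports are disjoint: within one degree by injectivity, across degrees because `-b < c < a`.
  have hΦ : ∀ i j (u : K i) (w : K j), Φ i u = Φ j w →
      (⟨i, u⟩ : Σ i, K i) = ⟨j, w⟩ := by
    intro i j u w huw
    have hδ := congrArg δ huw
    rcases u with u | u | u <;> rcases w with w | w | w <;>
      simp only [Φ, Sum.elim_inl, Sum.elim_inr, hδφa, hδφb, hδφc] at hδ huw
    · have := φa.injective (Subtype.ext huw); cases this; rfl
    · linarith
    · linarith
    · linarith
    · have := φb.injective (Subtype.ext huw); cases this; rfl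
    · linarith
    · linarith
    · linarith
    · have := φc.injective (Subtype.ext huw); cases this; rfl
  have hlen : ∀ i, ((Finset.univ : Finset (K i)).toList.map (Φ i)).length = x i + y i + r i :=
    fun i => by simp [K, add_assoc]
  refine ⟨fun i => (Finset.univ : Finset (K i)).toList.map (Φ i), fun i => ?_, fun i => ?_,
    fun i => ?_, ?_⟩
  · rw [List.map_map, Finset.sum_map_toList]
    simp only [K, Fintype.sum_sum_type, Φ, Function.comp_apply, Sum.elim_inl, Sum.elim_inr, hδφa,
      hδφb, hδφc, Finset.sum_const, Finset.card_univ, Fintype.card_fin, nsmul_eq_mul]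
    linear_combination hxy i
  · rw [← List.length_pos_iff, hlen]
    have := hx i
    omega
  · rw [hlen, Nat.odd_add, hpar]
    tauto
  · rw [List.nodup_flatten]
    constructor
    · intro l hl
      obtain ⟨i, -, rfl⟩ := List.mem_map.1 hl
      refine (Finset.nodup_toList _).map fun u w huw => ?_
      exact eq_of_heq (Sigma.mk.inj (hΦ i i u w huw)).2
    · rw [List.pairwise_map]
      refine (List.nodup_finRange n).imp fun {i j} hij v hv hv' => hij ?_
      obtain ⟨u, -, rfl⟩ := List.mem_map.1 hv
      obtain ⟨w, -, hw⟩ := List.mem_map.1 hv'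
      exact (congrArg Sigma.fst (hΦ j i w u hw)).symm

end Grading

/-! ### Graded identities follow from the generating polynomials -/

section Main

variable {F : Type*} [Field F]

/-- A combination of words lies in the ideal if all its polarizations do. -/
theorem sum_words_eq_zero [CharZero F] {X : Type*} {Q : Type*} [Ring Q]
    [Algebra F Q] (c : List X →₀ F) (x : X → Q)
    (h : ∀ (n : ℕ) (p : Fin n → X), ∑ σ : Equiv.Perm (Fin n),
      c (List.ofFn (p ∘ σ)) • ((List.ofFn (p ∘ σ)).map x).prod = 0) :
    c.sum (fun l r => r • (l.map x).prod) = 0 := by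
  classical
  have key : ∀ n, ∑ l ∈ c.support with l.length = n, c l • (l.map x).prod = 0 := by
    intro n
    let T : Finset X := c.support.biUnion List.toFinset
    let 𝒲 : Finset (Fin n → X) := Fintype.piFinset fun _ => T
    have h1 : ∑ p ∈ 𝒲, ∑ σ : Equiv.Perm (Fin n),
        c (List.ofFn (p ∘ σ)) • ((List.ofFn (p ∘ σ)).map x).prod = 0 :=
      Finset.sum_eq_zero fun p _ => h n p
    rw [Finset.sum_comm] at h1
    -- Each `σ` merely permutes the index set `𝒲`, so the total of all polarizations is `n!` times
    -- the length-`n` part, and `n!` is invertible.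
    have h2 : ∀ σ : Equiv.Perm (Fin n),
        ∑ p ∈ 𝒲, c (List.ofFn (p ∘ σ)) • ((List.ofFn (p ∘ σ)).map x).prod =
          ∑ p ∈ 𝒲, c (List.ofFn p) • ((List.ofFn p).map x).prod := fun σ => by
      refine Finset.sum_equiv (σ.symm.arrowCongr (Equiv.refl X)) (fun p => ?_) fun p _ => rfl
      simp only [𝒲, Fintype.mem_piFinset]
      exact ⟨fun h i => h (σ i), fun h i => by simpa using h (σ.symm i)⟩
    rw [Finset.sum_congr rfl fun σ _ => h2 σ, Finset.sum_const, ← Nat.cast_smul_eq_nsmul F,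
      smul_eq_zero_iff_right (Nat.cast_ne_zero.2
        (by simp [Fintype.card_perm, Nat.factorial_ne_zero]))] at h1
    refine Eq.trans (Eq.symm ?_) h1
    refine Finset.sum_bij_ne_zero (fun p _ _ => List.ofFn p) ?_ ?_ ?_ ?_
    · intro p _ hp
      refine Finset.mem_filter.2 ⟨Finsupp.mem_support_iff.2 fun h0 => hp ?_, by simp⟩
      rw [h0, zero_smul]
    · intro p _ _ q _ _ hpq
      exact List.ofFn_injective hpq
    · intro l hl hl0
      obtain ⟨hl1, rfl⟩ := Finset.mem_filter.1 hl
      refine ⟨l.get, Fintype.mem_piFinset.2 fun i => Finset.mem_biUnion.2 ⟨l, hl1, ?_⟩, ?_, ?_⟩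
      · exact List.mem_toFinset.2 (List.get_mem l i)
      · rwa [List.ofFn_get]
      · exact List.ofFn_get l
    · intro p _ _
      rfl
  rw [Finsupp.sum, ← Finset.sum_fiberwise_of_maps_to
    (t := c.support.image List.length) (g := List.length) fun l hl => Finset.mem_image_of_mem _ hl]
  exact Finset.sum_eq_zero fun n _ => key n

theorem mem_of_isGradedIdentity [CharZero F] {a b c : ℤ} {d k : ℕ} {δ : ℕ → ℤ}
    (ha : 0 < a) (hb : 0 < b) (hbc : -b < c) (hca : c < a)
    (hd : d = Int.gcd a b) (hcd : Int.gcd c d = 1) (heven : Even ((a / d) * (b / d)))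
    (hδa : {i : ℕ | δ i = a}.encard = ⊤) (hδb : {i : ℕ | δ i = -b}.encard = ⊤)
    (hδc : {i : ℕ | δ i = c}.encard = k) {I : TwoSidedIdeal (FreeGraded F)} (hI : IsTIdeal I)
    (h3 : tripleCommutators F ⊆ {f | f ∈ I}) (hlong : longProducts F d c k ⊆ {f | f ∈ I})
    {f : FreeGraded F} (hf : IsGradedIdentity (grassmannComponent F δ) f) : f ∈ I := by
  have hd0 : 0 < d := hd ▸ Int.gcd_pos_of_ne_zero_left _ ha.ne'
  obtain ⟨C, rfl⟩ := exists_sum_words f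
  have hπ : ∀ {A : Type _} [Ring A] [Algebra F A] (π : FreeGraded F →ₐ[F] A),
      π (C.sum fun l r => r • (l.map (FreeAlgebra.ι F)).prod) =
        C.sum fun l r => r • (l.map fun p => π (FreeAlgebra.ι F p)).prod := fun π => by
    rw [Finsupp.sum, map_sum]
    refine Finset.sum_congr rfl fun l _ => ?_
    rw [map_smul, map_list_prod, List.map_map]
    rfl
  rw [← mkₐ_eq_zero_iff (F := F), hπ]
  refine sum_words_eq_zero C _ fun n p => ?_
  by_cases hp : ∑ i, degResidue d c (p i).1 ≤ k
  · have := sum_perm_prod_eq_zero (centralCommutators_quotient hI h3)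
      (fun σ => C (List.ofFn (p ∘ σ)))
      (fun i => I.ringCon.mkₐ F (FreeAlgebra.ι F (p i))) fun J => ?_
    · simpa only [List.map_ofFn, Function.comp_def] using this
    · obtain ⟨l, hl, hl0, hlJ, hnd⟩ := exists_monomials ha hb hbc hca hd hcd heven hδa hδb hδc
        (fun i => (p i).1) J hp
      refine sum_perm_paritySubst_eq_zero p C l J hl0 hlJ hnd fun T => ?_
      have := hf (fun v => ∑ i with p i = v, if i ∈ T then extMon F (l i) else 0) fun v => ?_
      · rw [hπ] at this
        simpa only [FreeAlgebra.lift_ι_apply] using this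
      · refine sum_mem fun i hi => ?_
        split_ifs
        · rw [← (Finset.mem_filter.1 hi).2, ← hl i]
          exact prod_mem_monomialComponent (l i)
        · exact zero_mem _
  -- The residue sum is invariant under permuting letters, so every word of this polarization lies
  -- in `I` separately.
  · refine Finset.sum_eq_zero fun σ _ => ?_
    have hmem := word_mem_of_lt_sum hI hd0 hcd hlong (List.ofFn (p ∘ σ)) (by
      rw [List.map_ofFn, List.sum_ofFn]
      have := Equiv.sum_comp σ fun i => degResidue d c (p i).1
      simp only [Function.comp_apply]
      omega)
    rw [← mkₐ_eq_zero_iff (F := F), map_list_prod, List.map_map] at hmem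
    exact (congrArg _ hmem).trans (smul_zero _)

end Main

end GradedGrassmann

theorem mainTheorem8 {F : Type*} [Field F] [CharZero F]
    (a b c : ℤ) (ha : 0 < a) (hb : 0 < b) (hbc : -b < c) (hca : c < a)
    (hB : GradedGrassmann.ConditionBHat a b c)
    (d : ℕ) (hd : d = Int.gcd a b) (heven : Even ((a / d) * (b / d)))
    (k : ℕ) (hk : d - 1 ≤ k)
    (δ : ℕ → ℤ) (hδ : GradedGrassmann.IsInduced ![-b, c, a] ![⊤, (k : ℕ∞), ⊤] δ) :
    GradedGrassmann.gradedIdentities (GradedGrassmann.grassmannComponent F δ) =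
      GradedGrassmann.tIdealSpan
        (GradedGrassmann.tripleCommutators F ∪ GradedGrassmann.longProducts F d c k) := by
  open GradedGrassmann in
  have hd0 : 0 < d := hd ▸ Int.gcd_pos_of_ne_zero_left _ ha.ne'
  have hcd : Int.gcd c d = 1 := by
    rw [Int.gcd_comm, hd]
    exact hB.1
  obtain ⟨-, hval, hcard⟩ := hδ
  have hδb : {i : ℕ | δ i = -b}.encard = ⊤ := hcard 0
  have hδc : {i : ℕ | δ i = c}.encard = k := hcard 1
  have hδa : {i : ℕ | δ i = a}.encard = ⊤ := hcard 2
  have hda : (d : ℤ) ∣ a := hd ▸ Int.gcd_dvd_left _ _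
  have hdb : (d : ℤ) ∣ b := hd ▸ Int.gcd_dvd_right _ _
  have hδd : ∀ i, δ i = c ∨ (d : ℤ) ∣ δ i := fun i => by
    obtain ⟨j, hj⟩ := hval i
    fin_cases j
    · right; rw [hj]; exact hdb.neg_right
    · left; exact hj
    · right; rw [hj]; exact hda
  refine le_antisymm (fun f hf => ?_) (sInf_le ⟨isTIdeal_gradedIdentities, ?_⟩)
  · rw [tIdealSpan, TwoSidedIdeal.mem_sInf]
    rintro I ⟨hI, hS⟩
    exact mem_of_isGradedIdentity ha hb hbc hca hd hcd heven hδa hδb hδc hI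
      (Set.subset_union_left.trans hS) (Set.subset_union_right.trans hS)
      (mem_gradedIdentities.1 hf)
  · exact Set.union_subset (tripleCommutators_subset_gradedIdentities F δ)
      (longProducts_subset_gradedIdentities hd0 hcd hδd hδc)
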